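/- Let $\mathbb{Q}(t)$ be the field of rational functions in the variable $t$ over $\mathbb{Q}$, and let $\mathcal{L}_t$ be the first-order language $(<,+,0,1,(\lambda_q)_{q\in\mathbb{Q}(t)})$, where $<$ is a binary relation symbol, $+$ a binary function symbol, $0,1$ are constant symbols, and each $\lambda_q$ is a unary function symbol. Let $T_t$ be the $\mathcal{L}_t$-theory whose axioms state that a structure $\mathcal{M}=(M,<,+,0,1,(\lambda_q)_{q\in\mathbb{Q}(t)})$ satisfies the following. (ODAG with $1$) $(M,<,+,0)$ is a divisible (totally) ordered abelian group, and $0<1$. (T1) $(M,+,0,(\lambda_q)_{q\in\mathbb{Q}(t)})$ is a $\mathbb{Q}(t)$-vector space with scalar multiplication $(q,x)\mapsto\lambda_q(x)$. (T2) For every $m\in\mathbb{N}$ and all $q_1,\dots,q_m\in\mathbb{Q}(t)$ that are linearly independent over $\mathbb{Q}$, the image of the map $M\to M^m$, $x\mapsto(\lambda_{q_1}(x),\dots,\lambda_{q_m}(x))$, is dense in $M^m$ (for the product of the order topologies); that is, for all $a_1<b_1,\dots,a_m<b_m$ in $M$ there is $x\in M$ with $a_i<\lambda_{q_i}(x)<b_i$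 for all $i$. Then $T_t$ has quantifier elimination: for every $n\ge 0$ and every $\mathcal{L}_t$-formula $\varphi(x_1,\dots,x_n)$ there is a quantifier-free $\mathcal{L}_t$-formula $\psi(x_1,\dots,x_n)$ such that $T_t\models\forall x_1\cdots\forall x_n\,(\varphi\leftrightarrow\psi)$. -/

import Mathlib

open FirstOrder

namespace OrderedQtSpace

/-- Function symbols: `0`, `1`, `+`, and a unary symbol `λ_q` for every `q ∈ ℚ(t)`. -/
inductive Func : ℕ → Type
  | zero : Func 0
  | one : Func 0
  | smul (q : RatFunc ℚ) : Func 1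
  | add : Func 2

/-- The only relation symbol is the binary symbol `<`. -/
inductive Rel : ℕ → Type
  | lt : Rel 2

/-- The language `(<, +, 0, 1, (λ_q)_{q ∈ ℚ(t)})`. -/
def Lt : FirstOrder.Language.{0, 0} := ⟨Func, Rel⟩

variable {α : Type} {n : ℕ}

/-- The constant symbol `0` as a term. -/
def zeroT : Lt.Term α := FirstOrder.Language.Constants.term (L := Lt) Func.zero

/-- The constant symbol `1` as a term. -/
def oneT : Lt.Term α := FirstOrder.Language.Constants.term (L := Lt) Func.one

/-- The term `s + u`. -/
def addT (s u : Lt.Term α) : Lt.Term α := FirstOrder.Language.Functions.apply₂ (L := Lt) Func.add s u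

/-- The term `λ_q(s)`. -/
def smulT (q : RatFunc ℚ) (s : Lt.Term α) : Lt.Term α :=
  FirstOrder.Language.Functions.apply₁ (L := Lt) (Func.smul q) s

/-- The term `s + ⋯ + s` with `k` summands, that is, `k · s`. -/
def nsmulT : ℕ → Lt.Term α → Lt.Term α
  | 0, _ => zeroT
  | k + 1, s => addT (nsmulT k s) s

/-- The symbol `<`. -/
def ltSymb : Lt.Relations 2 := Rel.lt

/-- The atomic formula `s < u`. -/
def ltF (s u : Lt.Term (α ⊕ Fin n)) : Lt.BoundedFormula α n := ltSymb.boundedFormula₂ s u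

/-- The axioms of ordered divisible abelian groups with a distinguished positive element `1`. -/
inductive OdagAxiom : Lt.Sentence → Prop
  | add_assoc : OdagAxiom (∀' ∀' ∀' (addT (addT (&0) &1) &2 =' addT (&0) (addT (&1) &2)))
  | add_comm : OdagAxiom (∀' ∀' (addT (&0) &1 =' addT (&1) &0))
  | add_zero : OdagAxiom (∀' (addT (&0) zeroT =' &0))
  | exists_neg : OdagAxiom (∀' ∃' (addT (&0) &1 =' zeroT))
  | lt_irrefl : OdagAxiom (∀' ∼(ltF (&0) &0))
  | lt_trans : OdagAxiom (∀' ∀' ∀' (ltF (&0) &1 ⟹ ltF (&1) &2 ⟹ ltF (&0) &2))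
  | lt_trichotomy : OdagAxiom (∀' ∀' (ltF (&0) &1 ⊔ (((&0) =' &1) ⊔ ltF (&1) &0)))
  | add_lt_add : OdagAxiom (∀' ∀' ∀' (ltF (&0) &1 ⟹ ltF (addT (&0) &2) (addT (&1) &2)))
  | divisible (k : ℕ) (hk : 1 ≤ k) : OdagAxiom (∀' ∃' (nsmulT k (&1) =' &0))
  | zero_lt_one : OdagAxiom (ltF zeroT oneT)

/-- The axioms which, over those of an abelian group, say that `(λ_q)_{q ∈ ℚ(t)}` is the scalar
multiplication of a `ℚ(t)`-vector space. -/
inductive VectorSpaceAxiom : Lt.Sentence → Prop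
  | smul_add (q : RatFunc ℚ) :
      VectorSpaceAxiom (∀' ∀' (smulT q (addT (&0) &1) =' addT (smulT q (&0)) (smulT q (&1))))
  | add_smul (q r : RatFunc ℚ) :
      VectorSpaceAxiom (∀' (smulT (q + r) (&0) =' addT (smulT q (&0)) (smulT r (&0))))
  | mul_smul (q r : RatFunc ℚ) :
      VectorSpaceAxiom (∀' (smulT (q * r) (&0) =' smulT q (smulT r (&0))))
  | one_smul : VectorSpaceAxiom (∀' (smulT 1 (&0) =' &0))

/-- The sentence "for all `a₁ < b₁, …, aₘ < bₘ` there is `x` with `aᵢ < λ_{qᵢ}(x) < bᵢ` for all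
`i`". In an ordered group without endpoints the boxes `∏ (aᵢ, bᵢ)` form a base of the product of
the order topologies, so this says that the image of `x ↦ (λ_{q₁}(x), …, λ_{qₘ}(x))` is dense in
the `m`-th power. -/
noncomputable def densitySentence {m : ℕ} (q : Fin m → RatFunc ℚ) : Lt.Sentence :=
  FirstOrder.Language.Formula.iAlls (L := Lt) (α := Empty) (Fin m ⊕ Fin m) <|
    FirstOrder.Language.Formula.imp
      (FirstOrder.Language.Formula.iInf fun i : Fin m =>
        ltF (FirstOrder.Language.var (Sum.inl (Sum.inr (Sum.inl i))))
          (FirstOrder.Language.var (Sum.inl (Sum.inr (Sum.inr i)))))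
      (FirstOrder.Language.Formula.iExs Unit <| FirstOrder.Language.Formula.iInf fun i : Fin m =>
        ltF (FirstOrder.Language.var (Sum.inl (Sum.inl (Sum.inr (Sum.inl i)))))
            (smulT (q i) (FirstOrder.Language.var (Sum.inl (Sum.inr ())))) ⊓
          ltF (smulT (q i) (FirstOrder.Language.var (Sum.inl (Sum.inr ()))))
            (FirstOrder.Language.var (Sum.inl (Sum.inl (Sum.inr (Sum.inr i))))))

/-- The theory `T_t`: ordered divisible abelian groups with a distinguished positive element,
together with (T1) the `ℚ(t)`-vector space axioms and (T2) the density of the image of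
`(λ_{q₁}, …, λ_{qₘ})` whenever `q₁, …, qₘ` are linearly independent over `ℚ`. -/
noncomputable def Tt : Lt.Theory :=
  {φ | OdagAxiom φ} ∪ {φ | VectorSpaceAxiom φ} ∪
    {φ | ∃ (m : ℕ) (q : Fin m → RatFunc ℚ), LinearIndependent ℚ q ∧ φ = densitySentence q}

end OrderedQtSpace

/-- A theory has quantifier elimination if every formula is equivalent, modulo the theory, to a
quantifier-free formula in the same free variables. -/
def FirstOrder.Language.Theory.HasQuantifierElimination {L : FirstOrder.Language.{0, 0}}
    (T : L.Theory) : Prop :=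
  ∀ (n : ℕ) (φ : L.Formula (Fin n)),
    ∃ ψ : L.Formula (Fin n), FirstOrder.Language.BoundedFormula.IsQF ψ ∧ T.Iff φ ψ

namespace OrderedQtSpace

open FirstOrder.Language

/-! ### The algebraic structure of a model -/

section Model

variable (M : Tt.ModelType.{0, 0, 0})

/-! It is enough to eliminate one existential quantifier from a finite system of equations and
strict inequalities in `x`, the coefficients of `x` lying in ℚ(t). An equation with nonzero
coefficient determines `x`, which is then substituted. Otherwise only conditions `0 < qᵢ x + aᵢ`
involve `x`. One cannot divide by `qᵢ`: for nonconstant `q`, density lets `q x` have either sign for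
positive `x`.

Instead, write the `qᵢ` in terms of finitely many ℚ-linearly independent `eⱼ`. By (T2) the tuple
`(eⱼ x)` comes arbitrarily close to any tuple `(Xⱼ)`, and strict inequalities are open, so the
system is solvable in `x` iff it is solvable in independent unknowns `Xⱼ` with rational coefficients
(`exists_forall_pos_iff_of_linearIndependent`). Rational scalars respect the order, so
Fourier–Motzkin elimination removes the `Xⱼ` (`exists_list_forall_pos_iff`). The resulting
conditions do not depend on the model. -/

instance : Zero M := ⟨Structure.funMap (L := Lt) Func.zero ![]⟩

instance : One M := ⟨Structure.funMap (L := Lt) Func.one ![]⟩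

instance : Add M := ⟨fun x y => Structure.funMap (L := Lt) Func.add ![x, y]⟩

instance : SMul (RatFunc ℚ) M := ⟨fun q x => Structure.funMap (L := Lt) (Func.smul q) ![x]⟩

instance : LT M := ⟨fun x y => Structure.RelMap ltSymb ![x, y]⟩

variable {M} {α : Type} {n : ℕ}

@[simp]
theorem realize_zeroT (v : α → M) : zeroT.realize v = 0 :=
  congrArg (Structure.funMap (L := Lt) (M := M) Func.zero) (Subsingleton.elim _ _)

@[simp]
theorem realize_oneT (v : α → M) : oneT.realize v = 1 :=
  congrArg (Structure.funMap (L := Lt) (M := M) Func.one) (Subsingleton.elim _ _)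

@[simp]
theorem realize_addT (s u : Lt.Term α) (v : α → M) :
    (addT s u).realize v = s.realize v + u.realize v :=
  Term.realize_functions_apply₂

@[simp]
theorem realize_smulT (q : RatFunc ℚ) (s : Lt.Term α) (v : α → M) :
    (smulT q s).realize v = q • s.realize v :=
  Term.realize_functions_apply₁

@[simp]
theorem realize_ltF (s u : Lt.Term (α ⊕ Fin n)) (v : α → M) (xs : Fin n → M) :
    (ltF s u).Realize v xs ↔ s.realize (Sum.elim v xs) < u.realize (Sum.elim v xs) :=
  BoundedFormula.realize_rel₂

theorem realize_of_odagAxiom {φ : Lt.Sentence} (h : OdagAxiom φ) : (M : Type) ⊨ φ :=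
  Theory.realize_sentence_of_mem Tt (Or.inl (Or.inl h))

theorem realize_of_vectorSpaceAxiom {φ : Lt.Sentence} (h : VectorSpaceAxiom φ) :
    (M : Type) ⊨ φ :=
  Theory.realize_sentence_of_mem Tt (Or.inl (Or.inr h))

theorem model_add_assoc (x y z : M) : x + y + z = x + (y + z) := by
  simpa [Sentence.Realize, Formula.Realize, Fin.snoc] using
    realize_of_odagAxiom (M := M) .add_assoc x y z

theorem model_add_comm (x y : M) : x + y = y + x := by
  simpa [Sentence.Realize, Formula.Realize, Fin.snoc] using
    realize_of_odagAxiom (M := M) .add_comm x y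

theorem model_add_zero (x : M) : x + 0 = x := by
  simpa [Sentence.Realize, Formula.Realize, Fin.snoc] using
    realize_of_odagAxiom (M := M) .add_zero x

theorem model_exists_neg (x : M) : ∃ y, x + y = 0 := by
  simpa [Sentence.Realize, Formula.Realize, Fin.snoc] using
    (BoundedFormula.realize_all.1 (realize_of_odagAxiom (M := M) .exists_neg)) x

theorem model_lt_irrefl (x : M) : ¬ x < x := by
  simpa [Sentence.Realize, Formula.Realize, Fin.snoc] using
    (BoundedFormula.realize_all.1 (realize_of_odagAxiom (M := M) .lt_irrefl)) x

theorem model_lt_trans (x y z : M) : x < y → y < z → x < z := by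
  simpa [Sentence.Realize, Formula.Realize, Fin.snoc] using
    realize_of_odagAxiom (M := M) .lt_trans x y z

theorem model_lt_trichotomy (x y : M) : x < y ∨ x = y ∨ y < x := by
  have := realize_of_odagAxiom (M := M) .lt_trichotomy
  rw [Sentence.Realize, Formula.Realize, BoundedFormula.realize_all] at this
  have := this x
  rw [BoundedFormula.realize_all] at this
  simpa [Fin.snoc] using this y

theorem model_add_lt_add (x y z : M) : x < y → x + z < y + z := by
  simpa [Sentence.Realize, Formula.Realize, Fin.snoc] using
    realize_of_odagAxiom (M := M) .add_lt_add x y z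

theorem model_zero_lt_one : (0 : M) < 1 := by
  simpa [Sentence.Realize, Formula.Realize] using
    realize_of_odagAxiom (M := M) .zero_lt_one

theorem model_smul_add (q : RatFunc ℚ) (x y : M) : q • (x + y) = q • x + q • y := by
  simpa [Sentence.Realize, Formula.Realize, Fin.snoc] using
    realize_of_vectorSpaceAxiom (M := M) (.smul_add q) x y

theorem model_add_smul (q r : RatFunc ℚ) (x : M) : (q + r) • x = q • x + r • x := by
  simpa [Sentence.Realize, Formula.Realize, Fin.snoc] using
    realize_of_vectorSpaceAxiom (M := M) (.add_smul q r) x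

theorem model_mul_smul (q r : RatFunc ℚ) (x : M) : (q * r) • x = q • r • x := by
  simpa [Sentence.Realize, Formula.Realize, Fin.snoc] using
    realize_of_vectorSpaceAxiom (M := M) (.mul_smul q r) x

theorem model_one_smul (x : M) : (1 : RatFunc ℚ) • x = x := by
  simpa [Sentence.Realize, Formula.Realize, Fin.snoc] using
    realize_of_vectorSpaceAxiom (M := M) .one_smul x

noncomputable instance : Neg M := ⟨fun x => (model_exists_neg x).choose⟩

noncomputable instance : AddCommGroup M where
  add_assoc := model_add_assoc
  add_comm := model_add_comm
  add_zero := model_add_zero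
  zero_add x := (model_add_comm 0 x).trans (model_add_zero x)
  nsmul := nsmulRec
  zsmul := zsmulRec
  neg_add_cancel x := (model_add_comm _ x).trans (model_exists_neg x).choose_spec

noncomputable instance : Module (RatFunc ℚ) M where
  one_smul := model_one_smul
  mul_smul := model_mul_smul
  smul_add := model_smul_add
  smul_zero q := by simpa using model_smul_add q (0 : M) 0
  add_smul := model_add_smul
  zero_smul x := by simpa using model_add_smul 0 0 x

noncomputable instance : LinearOrder M where
  le x y := x < y ∨ x = y
  le_refl x := Or.inr rfl
  le_trans := by
    rintro x y z (h | rfl) (h' | rfl)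
    · exact Or.inl (model_lt_trans x y z h h')
    · exact Or.inl h
    · exact Or.inl h'
    · exact Or.inr rfl
  lt_iff_le_not_ge x y := by
    refine ⟨fun h => ⟨Or.inl h, ?_⟩, ?_⟩
    · rintro (h' | rfl)
      · exact model_lt_irrefl x (model_lt_trans x y x h h')
      · exact model_lt_irrefl _ h
    · rintro ⟨h | rfl, h'⟩
      · exact h
      · exact absurd (Or.inr rfl) h'
  le_antisymm := by
    rintro x y (h | rfl) (h' | h')
    · exact absurd (model_lt_trans x y x h h') (model_lt_irrefl x)
    · exact h'.symm
    · rfl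
    · rfl
  le_total x y := by
    rcases model_lt_trichotomy x y with h | h | h
    · exact Or.inl (Or.inl h)
    · exact Or.inl (Or.inr h)
    · exact Or.inr (Or.inl h)
  toDecidableLE := Classical.decRel _

instance : IsOrderedAddMonoid M where
  add_le_add_left x y h z := by
    rcases h with h | rfl
    · exact Or.inl (model_add_lt_add x y z h)
    · exact le_rfl

/-- The rational scalar multiplication of a model, restricted from `ℚ(t)`. -/
noncomputable instance : Module ℚ M := Module.compHom M (algebraMap ℚ (RatFunc ℚ))

/-- Multiplying `c • x` by the denominator gives a positive integer multiple of `x`; so positivity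
of rational scaling follows from the ordered group axioms alone. -/
theorem rat_smul_pos {c : ℚ} (hc : 0 < c) {x : M} (hx : 0 < x) : 0 < c • x := by
  have hd : (0 : ℚ) < c.den := by exact_mod_cast c.den_pos
  have hn : 0 < c.num.toNat := by have := Rat.num_pos.2 hc; omega
  have h : c.den • (c • x) = c.num.toNat • x := by
    rw [← Nat.cast_smul_eq_nsmul ℚ, smul_smul, ← Nat.cast_smul_eq_nsmul ℚ, mul_comm,
      Rat.mul_den_eq_num]
    congr 1
    exact_mod_cast (Int.toNat_of_nonneg (Rat.num_nonneg.2 hc.le)).symm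
  have h' : 0 < c.den • (c • x) := h ▸ nsmul_pos hx hn.ne'
  by_contra hneg
  exact absurd (nsmul_nonpos (not_lt.1 hneg) c.den) (not_le.2 h')

instance : PosSMulStrictMono ℚ M where
  smul_lt_smul_of_pos_left c hc x y hxy := by
    rw [← sub_pos, ← smul_sub]
    exact rat_smul_pos hc (sub_pos.2 hxy)

instance : Nontrivial M := ⟨0, 1, model_zero_lt_one.ne⟩

theorem exists_smul_mem_box {m : ℕ} {q : Fin m → RatFunc ℚ} (hq : LinearIndependent ℚ q)
    {a b : Fin m → M} (hab : ∀ i, a i < b i) : ∃ x : M, ∀ i, a i < q i • x ∧ q i • x < b i := by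
  have h : (M : Type) ⊨ densitySentence q :=
    Theory.realize_sentence_of_mem Tt (Or.inr ⟨m, q, hq, rfl⟩)
  rw [densitySentence, Sentence.Realize, Formula.realize_iAlls] at h
  have := h (Sum.elim a b)
  rw [Formula.realize_imp, Formula.realize_iInf, Formula.realize_iExs] at this
  obtain ⟨x, hx⟩ := this fun i => (realize_ltF ..).2 (by simpa using hab i)
  rw [Formula.realize_iInf] at hx
  refine ⟨x (), fun i => ?_⟩
  have := BoundedFormula.realize_inf.1 (hx i)
  simpa using this

end Model

/-! ### Fourier–Motzkin elimination in ordered rational vector spaces -/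

section FourierMotzkin

variable {M : Type*} [AddCommGroup M] [LinearOrder M] [IsOrderedAddMonoid M] [Module ℚ M]
  [PosSMulStrictMono ℚ M]

theorem denselyOrdered_of_rat_module : DenselyOrdered M where
  dense x y hxy := by
    refine ⟨x + (2⁻¹ : ℚ) • (y - x), ?_, ?_⟩
    · exact lt_add_of_pos_right _ (smul_pos (by norm_num) (sub_pos.2 hxy))
    · have h : (2⁻¹ : ℚ) • (y - x) + (2⁻¹ : ℚ) • (y - x) = y - x := by
        rw [← add_smul]; norm_num
      have h' : 0 < (2⁻¹ : ℚ) • (y - x) := smul_pos (by norm_num) (sub_pos.2 hxy)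
      calc x + (2⁻¹ : ℚ) • (y - x)
          < x + ((2⁻¹ : ℚ) • (y - x) + (2⁻¹ : ℚ) • (y - x)) := by
            gcongr; exact lt_add_of_pos_right _ h'
        _ = y := by rw [h]; abel

theorem pos_smul_add_iff_of_pos {c : ℚ} (hc : 0 < c) (x a : M) :
    0 < c • x + a ↔ -(c⁻¹ • a) < x := by
  rw [← smul_lt_smul_iff_of_pos_left (b₁ := -(c⁻¹ • a)) hc, smul_neg, smul_inv_smul₀ hc.ne', neg_lt_iff_pos_add]

theorem pos_smul_add_iff_of_neg {c : ℚ} (hc : c < 0) (x a : M) :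
    0 < c • x + a ↔ x < -(c⁻¹ • a) := by
  rw [← smul_lt_smul_iff_of_pos_left (b₁ := x) (neg_pos.2 hc), smul_neg, neg_smul, neg_smul,
    smul_inv_smul₀ hc.ne, neg_neg, neg_lt_iff_pos_add, add_comm]

variable [Nontrivial M]

theorem exists_between_finsets (lo hi : Finset M) (h : ∀ x ∈ lo, ∀ y ∈ hi, x < y) :
    ∃ m, (∀ x ∈ lo, x < m) ∧ ∀ y ∈ hi, m < y :=
  have : DenselyOrdered M := denselyOrdered_of_rat_module
  Order.exists_between_finsets lo hi h

/-- Each condition bounds `x` below, bounds it above, or does not involve it; a solution exists iff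
every lower bound is less than every upper bound. Denominators are cleared so that the comparisons
are again positivity conditions. -/
theorem exists_forall_pos_smul_add_iff {ι : Type*} (s : List ι) (c : ι → ℚ) (a : ι → M) :
    (∃ x : M, ∀ i ∈ s, 0 < c i • x + a i) ↔
      (∀ i ∈ s, c i = 0 → 0 < a i) ∧
        ∀ i ∈ s, ∀ j ∈ s, 0 < c i → c j < 0 → 0 < c i • a j + (-c j) • a i := by
  classical
  constructor
  · rintro ⟨x, hx⟩
    refine ⟨fun i hi h => by simpa [h] using hx i hi, fun i hi j hj hci hcj => ?_⟩
    have h := add_pos (smul_pos hci (hx j hj)) (smul_pos (neg_pos.2 hcj) (hx i hi))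
    convert h using 1
    module
  · rintro ⟨h0, h⟩
    obtain ⟨x, hlo, hhi⟩ := exists_between_finsets
      ((s.filter fun i => 0 < c i).map fun i => -((c i)⁻¹ • a i)).toFinset
      ((s.filter fun i => c i < 0).map fun i => -((c i)⁻¹ • a i)).toFinset (by
        simp only [List.mem_toFinset, List.mem_map, List.mem_filter, decide_eq_true_eq]
        rintro _ ⟨i, ⟨hi, hci⟩, rfl⟩ _ ⟨j, ⟨hj, hcj⟩, rfl⟩
        rw [← pos_smul_add_iff_of_pos hci]
        have := smul_pos (inv_pos.2 (neg_pos.2 hcj)) (h i hi j hj hci hcj)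
        convert this using 1
        rw [smul_add, smul_smul, smul_smul, inv_mul_cancel₀ (neg_pos.2 hcj).ne', one_smul,
          smul_neg, smul_smul, inv_neg, neg_mul, neg_smul, mul_comm])
    simp only [List.mem_toFinset, List.mem_map, List.mem_filter, decide_eq_true_eq,
      forall_exists_index, and_imp] at hlo hhi
    refine ⟨x, fun i hi => ?_⟩
    rcases lt_trichotomy (c i) 0 with hc | hc | hc
    · exact (pos_smul_add_iff_of_neg hc _ _).2 (hhi _ i hi hc rfl)
    · simpa [hc] using h0 i hi hc
    · exact (pos_smul_add_iff_of_pos hc _ _).2 (hlo _ i hi hc rfl)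

end FourierMotzkin

/-- Fourier–Motzkin elimination of all unknowns, uniformly in the ordered vector space `M` and in
the interpretation `f` of the constant terms. -/
theorem exists_list_forall_pos_iff {V : Type*} [AddCommGroup V] [Module ℚ V] (m : ℕ)
    (s : List ((Fin m → ℚ) × V)) :
    ∃ t : List V, ∀ (M : Type) [AddCommGroup M] [LinearOrder M] [IsOrderedAddMonoid M]
      [Module ℚ M] [PosSMulStrictMono ℚ M] [Nontrivial M] (f : V →+ M),
      (∃ X : Fin m → M, ∀ p ∈ s, 0 < ∑ j, p.1 j • X j + f p.2) ↔ ∀ a ∈ t, 0 < f a := by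
  induction m with
  | zero =>
    refine ⟨s.map Prod.snd, fun M _ _ _ _ _ _ f => ?_⟩
    simp [Fin.exists_fin_zero_pi]
  | succ m ih =>
    -- Eliminate the first unknown: keep the conditions free of it, and add for each pair with
    -- opposite signs the positive combination that cancels it.
    obtain ⟨t, ht⟩ := ih
      ((s.filter fun p => p.1 0 = 0).map (fun p => (Fin.tail p.1, p.2)) ++
        ((s.filter fun p => 0 < p.1 0).product (s.filter fun p => p.1 0 < 0)).map
          fun r => (r.1.1 0 • Fin.tail r.2.1 + (-r.2.1 0) • Fin.tail r.1.1,
            r.1.1 0 • r.2.2 + (-r.2.1 0) • r.1.2))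
    refine ⟨t, fun M _ _ _ _ _ _ f => ?_⟩
    rw [← ht M f]
    have key : ∀ X : Fin m → M, _ := fun X => exists_forall_pos_smul_add_iff s (fun p => p.1 0)
      (fun p => ∑ j, Fin.tail p.1 j • X j + f p.2)
    have h1 : (∃ X : Fin (m + 1) → M, ∀ p ∈ s, 0 < ∑ j, p.1 j • X j + f p.2) ↔
        ∃ (X : Fin m → M) (x : M), ∀ p ∈ s, 0 < p.1 0 • x + (∑ j, Fin.tail p.1 j • X j + f p.2) := by
      constructor
      · rintro ⟨X, hX⟩
        refine ⟨Fin.tail X, X 0, fun p hp => ?_⟩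
        have := hX p hp
        rwa [Fin.sum_univ_succ, add_assoc] at this
      · rintro ⟨X, x, hX⟩
        refine ⟨Fin.cons x X, fun p hp => ?_⟩
        have := hX p hp
        rw [Fin.sum_univ_succ, add_assoc]
        simpa [Fin.tail] using this
    rw [h1]
    refine exists_congr fun X => ?_
    rw [key, List.forall_mem_append, List.forall_mem_map, List.forall_mem_map]
    refine and_congr (by simp [List.mem_filter]) ?_
    have h2 : ∀ p r : (Fin (m + 1) → ℚ) × V,
        ∑ j, (p.1 0 • Fin.tail r.1 + (-r.1 0) • Fin.tail p.1) j • X j +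
          f (p.1 0 • r.2 + (-r.1 0) • p.2) =
        p.1 0 • (∑ j, Fin.tail r.1 j • X j + f r.2) +
          (-r.1 0) • (∑ j, Fin.tail p.1 j • X j + f p.2) := fun p r => by
      simp only [Pi.add_apply, Pi.smul_apply, smul_eq_mul, add_smul, Finset.sum_add_distrib,
        mul_smul, smul_add, Finset.smul_sum, map_add, map_rat_smul]
      abel
    simp only [h2]
    constructor
    · rintro h ⟨p, r⟩ hpr
      obtain ⟨hp, hr⟩ := List.pair_mem_product.1 hpr
      simp only [List.mem_filter, decide_eq_true_eq] at hp hr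
      exact h p hp.1 r hr.1 hp.2 hr.2
    · intro h p hp r hr hcp hcr
      exact h (p, r) (List.pair_mem_product.2 (by simp [*]))

/-! ### Solving systems of strict inequalities in one unknown -/

section Density

theorem exists_pos_forall_smul_lt {M : Type*} [AddCommGroup M] [LinearOrder M]
    [IsOrderedAddMonoid M] [Module ℚ M] [PosSMulStrictMono ℚ M] [Nontrivial M]
    {ι : Type*} (s : List ι) (c : ι → ℚ) (a : ι → M) (ha : ∀ i ∈ s, 0 < a i) :
    ∃ ε : M, 0 < ε ∧ ∀ i ∈ s, |c i| • ε < a i := by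
  classical
  -- The summand 1 keeps the divisor nonzero when `c i = 0`.
  have hpos : ∀ i, 0 < 1 + |c i| := fun i => by positivity
  obtain ⟨ε, h0, hε⟩ := exists_between_finsets {(0 : M)}
    ((s.map fun i => (1 + |c i|)⁻¹ • a i).toFinset) (by
      simp only [Finset.mem_singleton, List.mem_toFinset, List.mem_map]
      rintro _ rfl _ ⟨i, hi, rfl⟩
      exact smul_pos (inv_pos.2 (hpos i)) (ha i hi))
  have h0 : 0 < ε := h0 0 (Finset.mem_singleton_self 0)
  refine ⟨ε, h0, fun i hi => ?_⟩
  have h := hε _ (List.mem_toFinset.2 (List.mem_map.2 ⟨i, hi, rfl⟩))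
  rw [← smul_lt_smul_iff_of_pos_left (hpos i), smul_inv_smul₀ (hpos i).ne', add_smul,
    one_smul] at h
  exact (lt_add_of_pos_left _ h0).trans h

theorem neg_abs_smul_le_smul {M : Type*} [AddCommGroup M] [LinearOrder M]
    [IsOrderedAddMonoid M] [Module ℚ M] [PosSMulStrictMono ℚ M] (c : ℚ) {d ε : M}
    (h₁ : -ε ≤ d) (h₂ : d ≤ ε) : -(|c| • ε) ≤ c • d := by
  rcases le_total 0 c with hc | hc
  · rw [abs_of_nonneg hc, ← smul_neg]
    exact smul_le_smul_of_nonneg_left h₁ hc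
  · rw [abs_of_nonpos hc, neg_smul, neg_neg, ← neg_le_neg_iff, ← neg_smul, ← neg_smul]
    exact smul_le_smul_of_nonneg_left h₂ (neg_nonneg.2 hc)

variable {M : Tt.ModelType.{0, 0, 0}}

/-- The only use of density: a solution `X` has room around it, and some `(e j • x)` falls into that
room. -/
theorem exists_forall_pos_iff_of_linearIndependent {m : ℕ} {e : Fin m → RatFunc ℚ}
    (he : LinearIndependent ℚ e) {ι : Type*} (s : List ι) (q : ι → RatFunc ℚ)
    (c : ι → Fin m → ℚ) (hc : ∀ i ∈ s, q i = Fintype.linearCombination ℚ e (c i)) (a : ι → M) :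
    (∃ x : M, ∀ i ∈ s, 0 < q i • x + a i) ↔
      ∃ X : Fin m → M, ∀ i ∈ s, 0 < ∑ j, c i j • X j + a i := by
  have hsum : ∀ x : M, ∀ i ∈ s, q i • x = ∑ j, c i j • e j • x := fun x i hi => by
    rw [hc i hi, Fintype.linearCombination_apply]
    -- `q ↦ q • x` is additive, and additive maps between rational vector spaces are ℚ-linear.
    change (smulAddHom (RatFunc ℚ) M).flip x _ = ∑ j, c i j • (smulAddHom (RatFunc ℚ) M).flip x _
    rw [map_sum]
    exact Finset.sum_congr rfl fun j _ => map_rat_smul _ _ _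
  constructor
  · rintro ⟨x, hx⟩
    exact ⟨fun j => e j • x, fun i hi => hsum x i hi ▸ hx i hi⟩
  · rintro ⟨X, hX⟩
    -- Moving every `X j` by at most `ε` lowers the `i`-th form by at most `(∑ j, |c i j|) • ε`,
    -- which is less than its value.
    obtain ⟨ε, hε, h⟩ := exists_pos_forall_smul_lt s (fun i => ∑ j, |c i j|) _ hX
    obtain ⟨x, hx⟩ := exists_smul_mem_box he (a := fun j => X j - ε) (b := fun j => X j + ε)
      fun j => (sub_lt_self _ hε).trans (lt_add_of_pos_right _ hε)
    refine ⟨x, fun i hi => ?_⟩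
    have h1 : -(∑ j, |c i j| • ε) ≤ ∑ j, c i j • (e j • x - X j) := by
      rw [← Finset.sum_neg_distrib]
      refine Finset.sum_le_sum fun j _ => neg_abs_smul_le_smul _ ?_ ?_
      · rw [neg_le_sub_iff_le_add]; exact (sub_le_iff_le_add.1 (hx j).1.le)
      · rw [sub_le_iff_le_add']; exact (hx j).2.le
    have h2 := h i hi
    rw [abs_of_nonneg (Finset.sum_nonneg fun j _ => abs_nonneg _), Finset.sum_smul] at h2
    rw [hsum x i hi]
    simp only [smul_sub, Finset.sum_sub_distrib] at h1
    calc (0 : M) < ∑ j, c i j • X j + a i - ∑ j, |c i j| • ε := sub_pos.2 h2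
      _ = -(∑ j, |c i j| • ε) + (∑ j, c i j • X j + a i) := by abel
      _ ≤ (∑ j, c i j • e j • x - ∑ j, c i j • X j) + (∑ j, c i j • X j + a i) := by gcongr
      _ = ∑ j, c i j • e j • x + a i := by abel

/-- A finite family of elements of a rational vector space is expressed in a linearly independent
one. -/
theorem exists_linearIndependent_coordinates {V : Type*} [AddCommGroup V] [Module ℚ V]
    (s : List V) : ∃ (m : ℕ) (e : Fin m → V) (c : V → Fin m → ℚ), LinearIndependent ℚ e ∧
      ∀ q ∈ s, q = Fintype.linearCombination ℚ e (c q) := by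
  classical
  let W := Submodule.span ℚ (s.toFinset : Set V)
  let b := Module.finBasis ℚ W
  -- Coordinates outside the span are set to 0, a value that never matters.
  refine ⟨_, fun j => b j, fun q j => if h : q ∈ W then b.repr ⟨q, h⟩ j else 0,
    b.linearIndependent.map' W.subtype W.ker_subtype, fun q hq => ?_⟩
  have hW : q ∈ W := Submodule.subset_span (by simpa using hq)
  have h := congrArg W.subtype (b.sum_repr ⟨q, hW⟩)
  rw [map_sum] at h
  simpa only [Fintype.linearCombination_apply, dif_pos hW, map_smul, Submodule.subtype_apply]
    using h.symm

/-- Elimination of one unknown from a system of strict inequalities, uniformly in the model. -/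
theorem exists_list_forall_pos_smul_iff {V : Type*} [AddCommGroup V] [Module ℚ V]
    (s : List (RatFunc ℚ × V)) : ∃ t : List V, ∀ (M : Tt.ModelType.{0, 0, 0}) (f : V →+ M),
      (∃ x : M, ∀ p ∈ s, 0 < p.1 • x + f p.2) ↔ ∀ a ∈ t, 0 < f a := by
  -- The independent family depends only on the coefficients, hence serves all models at once.
  obtain ⟨m, e, c, he, hc⟩ := exists_linearIndependent_coordinates (s.map Prod.fst)
  obtain ⟨t, ht⟩ := exists_list_forall_pos_iff m (s.map fun p => (c p.1, p.2))
  refine ⟨t, fun M f => ?_⟩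
  rw [← ht M f, exists_forall_pos_iff_of_linearIndependent he s Prod.fst (fun p => c p.1)
    (fun p hp => hc _ (List.mem_map_of_mem hp)) fun p => f p.2]
  simp only [List.forall_mem_map]

end Density

/-! ### Linear forms with a constant term -/

/-- `ℚ(t)`-linear forms in the variables `γ` with a constant term from `ℚ(t) · 1`. -/
abbrev LinForm (γ : Type) : Type := (γ → RatFunc ℚ) × RatFunc ℚ

namespace LinForm

variable {γ : Type} [Fintype γ] {M : Tt.ModelType.{0, 0, 0}}

/-- The value of linear forms at a point. -/
noncomputable def eval (v : γ → M) : LinForm γ →ₗ[RatFunc ℚ] M :=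
  (Fintype.linearCombination (RatFunc ℚ) v).coprod (LinearMap.toSpanSingleton (RatFunc ℚ) M 1)

theorem eval_apply (v : γ → M) (ℓ : LinForm γ) :
    eval v ℓ = ∑ g, ℓ.1 g • v g + ℓ.2 • (1 : M) := by
  simp [eval, Fintype.linearCombination_apply]

/-- The coefficients of the variables other than the last bound one. -/
def init {α : Type} {n : ℕ} (ℓ : LinForm (α ⊕ Fin (n + 1))) : LinForm (α ⊕ Fin n) :=
  (fun g => ℓ.1 (g.map id Fin.castSucc), ℓ.2)

theorem eval_snoc {α : Type} [Fintype α] {n : ℕ} (ℓ : LinForm (α ⊕ Fin (n + 1))) (v : α → M)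
    (xs : Fin n → M) (x : M) :
    eval (Sum.elim v (Fin.snoc xs x : Fin (n + 1) → M)) ℓ =
      ℓ.1 (Sum.inr (Fin.last n)) • x + eval (Sum.elim v xs) ℓ.init := by
  simp only [eval_apply, Fintype.sum_sum_type, Sum.elim_inl, Sum.elim_inr, Fin.sum_univ_castSucc,
    Fin.snoc_castSucc, Fin.snoc_last, init, Sum.map_inl, Sum.map_inr, id_eq]
  abel

/-- Every term is given by a linear form, uniformly in the model. -/
theorem exists_eval_eq_realize (t : Lt.Term γ) :
    ∃ ℓ : LinForm γ, ∀ (M : Tt.ModelType.{0, 0, 0}) (v : γ → M), t.realize v = eval v ℓ := by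
  classical
  induction t with
  | var g =>
    refine ⟨(Pi.single g 1, 0), fun M v => ?_⟩
    simp [eval_apply, Pi.single_apply, ite_smul]
  | @func l f ts ih =>
    choose ℓ hℓ using ih
    cases f with
    | zero =>
      refine ⟨0, fun M v => ?_⟩
      rw [map_zero]
      exact congrArg (Structure.funMap (L := Lt) (M := M) Func.zero) (Subsingleton.elim _ _)
    | one =>
      refine ⟨(0, 1), fun M v => ?_⟩
      simp only [eval_apply, Pi.zero_apply, zero_smul, Finset.sum_const_zero, zero_add, one_smul]
      exact congrArg (Structure.funMap (L := Lt) (M := M) Func.one) (Subsingleton.elim _ _)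
    | smul q =>
      refine ⟨q • ℓ 0, fun M v => ?_⟩
      rw [map_smul, ← hℓ]
      exact congrArg (Structure.funMap (L := Lt) (M := M) (Func.smul q))
        (funext fun i => by fin_cases i; rfl)
    | add =>
      refine ⟨ℓ 0 + ℓ 1, fun M v => ?_⟩
      rw [map_add, ← hℓ, ← hℓ]
      exact congrArg (Structure.funMap (L := Lt) (M := M) Func.add)
        (funext fun i => by fin_cases i <;> rfl)

/-- Every linear form is given by a term, uniformly in the model. -/
theorem exists_realize_eq_eval (ℓ : LinForm γ) :
    ∃ t : Lt.Term γ, ∀ (M : Tt.ModelType.{0, 0, 0}) (v : γ → M), t.realize v = eval v ℓ := by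
  classical
  have h : ∀ s : Finset γ, ∃ t : Lt.Term γ, ∀ (M : Tt.ModelType.{0, 0, 0}) (v : γ → M),
      t.realize v = ∑ g ∈ s, ℓ.1 g • v g := fun s => by
    induction s using Finset.induction_on with
    | empty => exact ⟨zeroT, fun M v => by simp⟩
    | insert g s hg ih =>
      obtain ⟨t, ht⟩ := ih
      exact ⟨addT (smulT (ℓ.1 g) (Term.var g)) t, fun M v => by
        simp [ht, Finset.sum_insert hg]⟩
  obtain ⟨t, ht⟩ := h Finset.univ
  exact ⟨addT t (smulT ℓ.2 oneT), fun M v => by simp [ht, eval_apply]⟩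

end LinForm

/-! ### Systems of linear conditions and their finite disjunctions -/

/-- A finite system of equations and strict inequalities. -/
structure LinSystem (γ : Type) where
  /-- The forms required to vanish. -/
  eqs : List (LinForm γ)
  /-- The forms required to be positive. -/
  ineqs : List (LinForm γ)

variable {γ : Type} [Fintype γ]

/-- The point `v` solves the system. -/
def LinSystem.Holds (c : LinSystem γ) (M : Tt.ModelType.{0, 0, 0}) (v : γ → M) : Prop :=
  (∀ ℓ ∈ c.eqs, LinForm.eval v ℓ = 0) ∧ ∀ ℓ ∈ c.ineqs, 0 < LinForm.eval v ℓ

/-- A relation, given uniformly in all models, is semilinear if it is a finite disjunction of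
systems of linear equations and strict inequalities. -/
def IsSemilinear (P : ∀ M : Tt.ModelType.{0, 0, 0}, (γ → M) → Prop) : Prop :=
  ∃ S : List (LinSystem γ), ∀ M v, P M v ↔ ∃ c ∈ S, c.Holds M v

namespace IsSemilinear

variable {P Q : ∀ M : Tt.ModelType.{0, 0, 0}, (γ → M) → Prop}

theorem congr (hP : IsSemilinear P) (h : ∀ M v, Q M v ↔ P M v) : IsSemilinear Q := by
  obtain ⟨S, hS⟩ := hP
  exact ⟨S, fun M v => (h M v).trans (hS M v)⟩

theorem holds (c : LinSystem γ) : IsSemilinear c.Holds := ⟨[c], by simp⟩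

theorem eval_eq_zero (ℓ : LinForm γ) : IsSemilinear fun _ v => LinForm.eval v ℓ = 0 :=
  (holds ⟨[ℓ], []⟩).congr fun M v => by simp [LinSystem.Holds]

theorem eval_pos (ℓ : LinForm γ) : IsSemilinear fun _ v => 0 < LinForm.eval v ℓ :=
  (holds ⟨[], [ℓ]⟩).congr fun M v => by simp [LinSystem.Holds]

theorem false : IsSemilinear (γ := γ) fun _ _ => False := ⟨[], by simp⟩

theorem true : IsSemilinear (γ := γ) fun _ _ => True :=
  (holds ⟨[], []⟩).congr fun M v => by simp [LinSystem.Holds]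

theorem or (hP : IsSemilinear P) (hQ : IsSemilinear Q) :
    IsSemilinear fun M v => P M v ∨ Q M v := by
  obtain ⟨S, hS⟩ := hP
  obtain ⟨T, hT⟩ := hQ
  exact ⟨S ++ T, fun M v => by simp [hS, hT, or_and_right, exists_or]⟩

theorem and (hP : IsSemilinear P) (hQ : IsSemilinear Q) :
    IsSemilinear fun M v => P M v ∧ Q M v := by
  obtain ⟨S, hS⟩ := hP
  obtain ⟨T, hT⟩ := hQ
  refine ⟨(S.product T).map fun p => ⟨p.1.eqs ++ p.2.eqs, p.1.ineqs ++ p.2.ineqs⟩,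
    fun M v => ?_⟩
  refine (and_congr (hS M v) (hT M v)).trans ⟨?_, ?_⟩
  · rintro ⟨⟨c, hc, hcv⟩, d, hd, hdv⟩
    exact ⟨_, List.mem_map_of_mem (List.pair_mem_product.2 ⟨hc, hd⟩),
      List.forall_mem_append.2 ⟨hcv.1, hdv.1⟩, List.forall_mem_append.2 ⟨hcv.2, hdv.2⟩⟩
  · rintro ⟨_, he, hv⟩
    obtain ⟨⟨c, d⟩, hcd, rfl⟩ := List.mem_map.1 he
    obtain ⟨hc, hd⟩ := List.pair_mem_product.1 hcd
    obtain ⟨h1, h2⟩ := List.forall_mem_append.1 hv.1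
    obtain ⟨h3, h4⟩ := List.forall_mem_append.1 hv.2
    exact ⟨⟨c, hc, h1, h3⟩, d, hd, h2, h4⟩

theorem list_exists {ι : Type*} (s : List ι)
    {P : ι → ∀ M : Tt.ModelType.{0, 0, 0}, (γ → M) → Prop} (h : ∀ i, IsSemilinear (P i)) :
    IsSemilinear fun M v => ∃ i ∈ s, P i M v := by
  induction s with
  | nil => exact false.congr (by simp)
  | cons i s ih => exact ((h i).or ih).congr (by simp)

theorem list_forall {ι : Type*} (s : List ι)
    {P : ι → ∀ M : Tt.ModelType.{0, 0, 0}, (γ → M) → Prop} (h : ∀ i, IsSemilinear (P i)) :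
    IsSemilinear fun M v => ∀ i ∈ s, P i M v := by
  induction s with
  | nil => exact true.congr (by simp)
  | cons i s ih => exact ((h i).and ih).congr (by simp)

/-- By totality of the order, `ℓ ≠ 0` and `¬ 0 < ℓ` are disjunctions of conditions on `ℓ` and `-ℓ`.
-/
theorem not (hP : IsSemilinear P) : IsSemilinear fun M v => ¬ P M v := by
  obtain ⟨S, hS⟩ := hP
  refine (list_forall S (P := fun c M v => (∃ ℓ ∈ c.eqs, 0 < LinForm.eval v ℓ ∨
    0 < LinForm.eval v (-ℓ)) ∨ ∃ ℓ ∈ c.ineqs, LinForm.eval v ℓ = 0 ∨ 0 < LinForm.eval v (-ℓ))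
    fun c => (list_exists _ fun ℓ => (eval_pos ℓ).or (eval_pos (-ℓ))).or
      (list_exists _ fun ℓ => (eval_eq_zero ℓ).or (eval_pos (-ℓ)))).congr fun M v => ?_
  rw [hS]
  push Not
  refine forall₂_congr fun c _ => ?_
  rw [LinSystem.Holds, not_and_or]
  push Not
  simp only [map_neg, neg_pos, le_iff_eq_or_lt, ne_iff_lt_or_gt, or_comm]

/-- Elimination of one unknown from a system. -/
theorem exists_system (E I : List (RatFunc ℚ × LinForm γ)) :
    IsSemilinear fun M v => ∃ x : M, (∀ p ∈ E, p.1 • x + LinForm.eval v p.2 = 0) ∧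
      ∀ p ∈ I, 0 < p.1 • x + LinForm.eval v p.2 := by
  -- Substituting the solution of such an equation uses only vector space operations, so the lack of
  -- monotonicity of `λ_q` does no harm.
  by_cases h : ∃ p ∈ E, p.1 ≠ 0
  · obtain ⟨p, hp, hp0⟩ := h
    have hx : ∀ (M : Tt.ModelType.{0, 0, 0}) (v : γ → M) (r : RatFunc ℚ × LinForm γ),
        LinForm.eval v (r.2 - (r.1 * p.1⁻¹) • p.2) =
          r.1 • (-(p.1⁻¹ • LinForm.eval v p.2)) + LinForm.eval v r.2 := fun M v r => by
      rw [map_sub, map_smul, smul_neg, smul_smul]; abel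
    refine (holds ⟨E.map fun r => r.2 - (r.1 * p.1⁻¹) • p.2,
      I.map fun r => r.2 - (r.1 * p.1⁻¹) • p.2⟩).congr fun M v => ?_
    simp only [LinSystem.Holds, List.forall_mem_map, hx]
    refine ⟨?_, fun h => ⟨_, h⟩⟩
    rintro ⟨x, hE, hI⟩
    have : x = -(p.1⁻¹ • LinForm.eval v p.2) := by
      rw [← smul_neg, ← eq_neg_of_add_eq_zero_left (hE p hp), inv_smul_smul₀ hp0]
    exact this ▸ ⟨hE, hI⟩
  · push Not at h
    obtain ⟨t, ht⟩ := exists_list_forall_pos_smul_iff I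
    refine (holds ⟨E.map Prod.snd, t⟩).congr fun M v => ?_
    have := ht M (LinForm.eval v).toAddMonoidHom
    simp only [LinearMap.toAddMonoidHom_coe] at this
    rw [LinSystem.Holds, ← this, List.forall_mem_map, ← exists_and_left]
    refine exists_congr fun x => and_congr_left fun _ => forall₂_congr fun p hp => ?_
    rw [h p hp, zero_smul, zero_add]

/-- The existential quantifier distributes over the finite disjunction, leaving one system at a
time. -/
theorem exists_snoc {α : Type} [Fintype α] {n : ℕ}
    {P : ∀ M : Tt.ModelType.{0, 0, 0}, (α ⊕ Fin (n + 1) → M) → Prop} (hP : IsSemilinear P) :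
    IsSemilinear fun M (v : α ⊕ Fin n → M) =>
      ∃ x : M, P M (Sum.elim (v ∘ Sum.inl) (Fin.snoc (v ∘ Sum.inr) x : Fin (n + 1) → M)) := by
  obtain ⟨S, hS⟩ := hP
  refine (list_exists S fun c => exists_system
    (c.eqs.map fun ℓ => (ℓ.1 (Sum.inr (Fin.last n)), ℓ.init))
    (c.ineqs.map fun ℓ => (ℓ.1 (Sum.inr (Fin.last n)), ℓ.init))).congr fun M v => ?_
  simp only [hS, List.forall_mem_map, LinSystem.Holds, LinForm.eval_snoc, Sum.elim_comp_inl_inr]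
  constructor
  · rintro ⟨x, c, hc, h⟩; exact ⟨c, hc, x, h⟩
  · rintro ⟨c, hc, x, h⟩; exact ⟨x, c, hc, h⟩

theorem realize {α : Type} [Fintype α] {n : ℕ} (φ : Lt.BoundedFormula α n) :
    IsSemilinear fun M (v : α ⊕ Fin n → M) => φ.Realize (v ∘ Sum.inl) (v ∘ Sum.inr) := by
  induction φ with
  | falsum => exact false
  | equal s u =>
    obtain ⟨k, hk⟩ := LinForm.exists_eval_eq_realize s
    obtain ⟨l, hl⟩ := LinForm.exists_eval_eq_realize u
    refine (eval_eq_zero (k - l)).congr fun M v => ?_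
    rw [map_sub, sub_eq_zero, ← hk, ← hl, BoundedFormula.Realize, Sum.elim_comp_inl_inr]
  | rel R ts =>
    cases R
    obtain ⟨k, hk⟩ := LinForm.exists_eval_eq_realize (ts 0)
    obtain ⟨l, hl⟩ := LinForm.exists_eval_eq_realize (ts 1)
    refine (eval_pos (l - k)).congr fun M v => ?_
    rw [map_sub, sub_pos, ← hk, ← hl]
    change Structure.RelMap ltSymb (fun i => (ts i).realize (Sum.elim _ _)) ↔
      Structure.RelMap ltSymb ![_, _]
    rw [Sum.elim_comp_inl_inr]
    exact iff_of_eq (congrArg _ (funext fun i => by fin_cases i <;> rfl))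
  | imp _ _ h₁ h₂ =>
    exact (h₁.not.or h₂).congr fun M v => by rw [BoundedFormula.realize_imp, imp_iff_not_or]
  | all _ h =>
    -- `∀` is treated as `¬ ∃ ¬`.
    refine (exists_snoc h.not).not.congr fun M v => ?_
    simp [BoundedFormula.realize_all]

/-- The way back to syntax: linear forms are values of terms, so each system is a conjunction of
atomic formulas. -/
theorem exists_isQF {α : Type} [Fintype α] {n : ℕ}
    {P : ∀ M : Tt.ModelType.{0, 0, 0}, (α ⊕ Fin n → M) → Prop} (hP : IsSemilinear P) :
    ∃ ψ : Lt.BoundedFormula α n, ψ.IsQF ∧ ∀ (M : Tt.ModelType.{0, 0, 0}) v xs,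
      ψ.Realize v xs ↔ P M (Sum.elim v xs) := by
  have hlist : ∀ (A : ∀ M : Tt.ModelType.{0, 0, 0}, (α ⊕ Fin n → M) → LinForm (α ⊕ Fin n) → Prop),
      (∀ ℓ, ∃ ψ : Lt.BoundedFormula α n, ψ.IsQF ∧ ∀ (M : Tt.ModelType.{0, 0, 0}) v xs,
        ψ.Realize v xs ↔ A M (Sum.elim v xs) ℓ) →
      ∀ s : List (LinForm (α ⊕ Fin n)), ∃ ψ : Lt.BoundedFormula α n, ψ.IsQF ∧
        ∀ (M : Tt.ModelType.{0, 0, 0}) v xs, ψ.Realize v xs ↔ ∀ ℓ ∈ s, A M (Sum.elim v xs) ℓ := by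
    intro A hA s
    induction s with
    | nil => exact ⟨⊤, .top, by simp⟩
    | cons ℓ s ih =>
      obtain ⟨ψ, hψ, h⟩ := ih
      obtain ⟨θ, hθ, h'⟩ := hA ℓ
      exact ⟨θ ⊓ ψ, hθ.inf hψ, by simp [h, h']⟩
  obtain ⟨S, hS⟩ := hP
  simp only [hS]
  clear hS
  induction S with
  | nil => exact ⟨⊥, BoundedFormula.isQF_bot, by simp⟩
  | cons c S ih =>
    obtain ⟨ψ, hψ, h⟩ := ih
    obtain ⟨θ, hθ, hE⟩ := hlist (fun _ v ℓ => LinForm.eval v ℓ = 0) (fun ℓ => by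
      obtain ⟨t, ht⟩ := LinForm.exists_realize_eq_eval ℓ
      exact ⟨t.bdEqual zeroT, (BoundedFormula.IsAtomic.equal _ _).isQF, by simp [ht]⟩) c.eqs
    obtain ⟨χ, hχ, hI⟩ := hlist (fun _ v ℓ => 0 < LinForm.eval v ℓ) (fun ℓ => by
      obtain ⟨t, ht⟩ := LinForm.exists_realize_eq_eval ℓ
      exact ⟨ltF zeroT t, (BoundedFormula.IsAtomic.rel _ _).isQF, by simp [ht]⟩) c.ineqs
    exact ⟨(θ ⊓ χ) ⊔ ψ, (hθ.inf hχ).sup hψ, by simp [h, hE, hI, LinSystem.Holds]⟩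

end IsSemilinear

end OrderedQtSpace


theorem mainTheorem6 : OrderedQtSpace.Tt.HasQuantifierElimination := by
  intro n φ
  obtain ⟨ψ, hψ, h⟩ := (OrderedQtSpace.IsSemilinear.realize φ).exists_isQF
  refine ⟨ψ, hψ, fun M v xs => ?_⟩
  rw [FirstOrder.Language.BoundedFormula.realize_iff]
  simpa using (h M v xs).symm
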